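/- Let $n\ge 0$, let $\lambda$ be a partition of $n$ with conjugate partition $\lambda'$, and let $R$ be a principal ideal domain. Let $S^\lambda_{\mathbb Z}$ be the Specht $\mathbb Z\mathfrak S_n$-lattice, i.e. the $\mathbb Z\mathfrak S_n$-submodule generated by a $\lambda$-polytabloid $e_t=\sum_{\sigma\in C_t}\operatorname{sgn}(\sigma)\{\sigma t\}$ in the permutation module with $\mathbb Z$-basis the $\lambda$-tabloids (where $C_t$ is the column stabilizer of the $\lambda$-tableau $t$), and put $S^\lambda_R:=R\otimes_{\mathbb Z}S^\lambda_{\mathbb Z}$. Let $\operatorname{sgn}_R$ be the module $R$ on which $\sigma\in\mathfrak S_n$ acts by multiplication with $\operatorname{sgn}(\sigma)$, and let $(-)^*=\operatorname{Hom}_R(-,R)$ with the contragredient action. Then $S^{\lambda'}_R\otimes_R\operatorname{sgn}_R$ and $(S^\lambda_R)^*$ are $R\mathfrak S_n$-lattices (that is, finitely generated and free over $R$), and there is an isomorphism of $R\mathfrak S_n$-lattices $$S^{\lambda'}_R\otimes_R\operatorname{sgn}_R\;\cong\;(S^\lambda_R)^*.$$ -/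

import Mathlib

open scoped TensorProduct

noncomputable section

/-! ### Partitions, Young diagrams and conjugation -/

/-- The Young diagram `[p]` of a partition `p` of `n`: the left-aligned diagram whose row lengths are
the parts of `p` in weakly decreasing order (cells are pairs (row, column), counted from `0`). -/
def Nat.Partition.diagram {n : ℕ} (p : n.Partition) : YoungDiagram :=
  YoungDiagram.ofRowLens (p.parts.sort (· ≥ ·)) (Multiset.pairwise_sort p.parts (· ≥ ·)).sortedGE

theorem YoungDiagram.sum_rowLens (μ : YoungDiagram) : μ.rowLens.sum = μ.card := by
  have h : μ.card = ∑ i ∈ Finset.range (μ.colLen 0), (μ.row i).card := by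
    rw [YoungDiagram.card]
    have hm : (μ.cells : Set (ℕ × ℕ)).MapsTo Prod.fst (Finset.range (μ.colLen 0)) := by
      intro c hc
      have hc' : (c.1, c.2) ∈ μ := hc
      have h0 : (c.1, 0) ∈ μ := μ.up_left_mem le_rfl (Nat.zero_le _) hc'
      simpa using YoungDiagram.mem_iff_lt_colLen.1 h0
    rw [Finset.card_eq_sum_card_fiberwise hm]
    rfl
  rw [h, YoungDiagram.rowLens, ← Finset.sum_map_val, Finset.range_val]
  simp only [← YoungDiagram.rowLen_eq_card, Multiset.range, Multiset.map_coe, Multiset.sum_coe]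

theorem Nat.Partition.rowLens_diagram {n : ℕ} (p : n.Partition) :
    p.diagram.rowLens = p.parts.sort (· ≥ ·) :=
  YoungDiagram.rowLens_ofRowLens_eq_self fun _ hx => p.parts_pos ((Multiset.mem_sort _).1 hx)

theorem Nat.Partition.card_diagram {n : ℕ} (p : n.Partition) : p.diagram.card = n := by
  rw [← YoungDiagram.sum_rowLens, p.rowLens_diagram, ← Multiset.sum_coe, Multiset.sort_eq,
    p.parts_sum]

theorem YoungDiagram.card_transpose (μ : YoungDiagram) : μ.transpose.card = μ.card := by
  simp [YoungDiagram.card, YoungDiagram.transpose]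

/-- The conjugate partition `p'`, whose parts are the row lengths of the transposed diagram. -/
def Nat.Partition.conjugate {n : ℕ} (p : n.Partition) : n.Partition where
  parts := (p.diagram.transpose.rowLens : Multiset ℕ)
  parts_pos := fun hi => YoungDiagram.pos_of_mem_rowLens _ _ (Multiset.mem_coe.1 hi)
  parts_sum := by
    rw [Multiset.sum_coe, YoungDiagram.sum_rowLens, YoungDiagram.card_transpose, p.card_diagram]

theorem Nat.Partition.diagram_conjugate {n : ℕ} (p : n.Partition) :
    p.conjugate.diagram = p.diagram.transpose := by
  have h : p.conjugate.parts.sort (· ≥ ·) = p.diagram.transpose.rowLens := by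
    refine (Multiset.coe_eq_coe.1 (?_ : ((_ : List ℕ) : Multiset ℕ) = _)).eq_of_pairwise'
      (Multiset.pairwise_sort _ (· ≥ ·)) (YoungDiagram.rowLens_sorted _).pairwise
    rw [Multiset.sort_eq]
    rfl
  rw [← YoungDiagram.ofRowLens_to_rowLens_eq_self (μ := p.diagram.transpose)]
  unfold Nat.Partition.diagram
  congr 1

namespace Specht

/-! ### Tableaux and tabloids -/

/-- A `p`-tableau: a bijective filling of the cells of the diagram of `p` by the `n` symbols. -/
def Tableau {n : ℕ} (p : n.Partition) : Type :=
  {c : ℕ × ℕ // c ∈ p.diagram.cells} ≃ Fin n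

namespace Tableau

variable {n : ℕ} {p : n.Partition}

instance : Nonempty (Tableau p) :=
  ⟨Fintype.equivFinOfCardEq (by simpa [YoungDiagram.card] using p.card_diagram)⟩

/-- The row of `t` containing the symbol `i`. -/
def rowOf (t : Tableau p) (i : Fin n) : ℕ := (Equiv.symm t i).1.1

/-- The column of `t` containing the symbol `i`. -/
def colOf (t : Tableau p) (i : Fin n) : ℕ := (Equiv.symm t i).1.2

/-- The symmetric group acts on tableaux by acting on the entries. -/
instance : MulAction (Equiv.Perm (Fin n)) (Tableau p) where
  smul σ t := Equiv.trans t σ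
  one_smul _ := rfl
  mul_smul _ _ _ := rfl

theorem rowOf_smul (σ : Equiv.Perm (Fin n)) (t : Tableau p) (i : Fin n) :
    (σ • t).rowOf i = t.rowOf (σ⁻¹ i) := rfl

theorem colOf_smul (σ : Equiv.Perm (Fin n)) (t : Tableau p) (i : Fin n) :
    (σ • t).colOf i = t.colOf (σ⁻¹ i) := rfl

/-- The row stabilizer `R_t`: the permutations mapping every row of `t` to itself. -/
def rowStabilizer (t : Tableau p) : Subgroup (Equiv.Perm (Fin n)) where
  carrier := {σ | ∀ i, t.rowOf (σ i) = t.rowOf i}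
  one_mem' := fun _ => rfl
  mul_mem' := fun {a b} ha hb i => (ha (b i)).trans (hb i)
  inv_mem' := fun {a} ha i => by simpa using (ha (a⁻¹ i)).symm

/-- The column stabilizer `C_t`: the permutations mapping every column of `t` to itself. -/
def colStabilizer (t : Tableau p) : Subgroup (Equiv.Perm (Fin n)) where
  carrier := {σ | ∀ i, t.colOf (σ i) = t.colOf i}
  one_mem' := fun _ => rfl
  mul_mem' := fun {a b} ha hb i => (ha (b i)).trans (hb i)
  inv_mem' := fun {a} ha i => by simpa using (ha (a⁻¹ i)).symm

theorem mem_rowStabilizer {t : Tableau p} {σ : Equiv.Perm (Fin n)} :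
    σ ∈ t.rowStabilizer ↔ ∀ i, t.rowOf (σ i) = t.rowOf i := Iff.rfl

theorem mem_colStabilizer {t : Tableau p} {σ : Equiv.Perm (Fin n)} :
    σ ∈ t.colStabilizer ↔ ∀ i, t.colOf (σ i) = t.colOf i := Iff.rfl

instance (t : Tableau p) : DecidablePred (· ∈ t.colStabilizer) :=
  fun σ => inferInstanceAs (Decidable (∀ i, t.colOf (σ i) = t.colOf i))

theorem mem_rowStabilizer_smul {t : Tableau p} {σ π : Equiv.Perm (Fin n)} :
    σ ∈ (π • t).rowStabilizer ↔ π⁻¹ * σ * π ∈ t.rowStabilizer := by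
  simp only [mem_rowStabilizer, rowOf_smul, Equiv.Perm.mul_apply]
  exact ⟨fun h i => by simpa using h (π i), fun h i => by simpa using h (π⁻¹ i)⟩

theorem mem_colStabilizer_smul {t : Tableau p} {σ π : Equiv.Perm (Fin n)} :
    σ ∈ (π • t).colStabilizer ↔ π⁻¹ * σ * π ∈ t.colStabilizer := by
  simp only [mem_colStabilizer, colOf_smul, Equiv.Perm.mul_apply]
  exact ⟨fun h i => by simpa using h (π i), fun h i => by simpa using h (π⁻¹ i)⟩

theorem exists_smul_eq (t s : Tableau p) : ∃ π : Equiv.Perm (Fin n), π • t = s :=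
  ⟨(Equiv.symm t).trans s, Equiv.ext fun c =>
    congrArg (Equiv.toFun s) (Equiv.symm_apply_apply t c)⟩

end Tableau

/-- Two tableaux are row equivalent if an element of the row stabilizer carries one to the other. -/
def rowSetoid {n : ℕ} (p : n.Partition) : Setoid (Tableau p) where
  r t s := ∃ σ ∈ t.rowStabilizer, σ • t = s
  iseqv :=
    { refl := fun t => ⟨1, one_mem _, one_smul _ _⟩
      symm := by
        rintro t _ ⟨σ, hσ, rfl⟩
        refine ⟨σ⁻¹, ?_, inv_smul_smul _ _⟩
        rw [Tableau.mem_rowStabilizer_smul]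
        simpa using hσ
      trans := by
        rintro t _ _ ⟨σ, hσ, rfl⟩ ⟨τ, hτ, rfl⟩
        rw [Tableau.mem_rowStabilizer_smul] at hτ
        refine ⟨τ * σ, ?_, mul_smul _ _ _⟩
        have := mul_mem hσ hτ
        simpa [mul_assoc] using this }

/-- The set of `p`-tabloids: row equivalence classes `{t} = {σ t : σ ∈ R_t}` of tableaux. -/
def Tabloid {n : ℕ} (p : n.Partition) : Type := Quotient (rowSetoid p)

/-- The tabloid `{t}` of a tableau `t`. -/
def Tableau.tabloid {n : ℕ} {p : n.Partition} (t : Tableau p) : Tabloid p :=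
  Quotient.mk (rowSetoid p) t

/-- The action on tabloids induced by the action on tableaux. -/
instance {n : ℕ} {p : n.Partition} : MulAction (Equiv.Perm (Fin n)) (Tabloid p) where
  smul π := Quotient.map (π • ·) (by
    rintro t _ ⟨σ, hσ, rfl⟩
    refine ⟨π * σ * π⁻¹, ?_, by simp [mul_smul]⟩
    rw [Tableau.mem_rowStabilizer_smul]
    simpa [mul_assoc] using hσ)
  one_smul x := Quotient.inductionOn x fun t => congrArg _ (one_smul _ t)
  mul_smul a b x := Quotient.inductionOn x fun t => congrArg _ (mul_smul a b t)

theorem smul_tabloid {n : ℕ} {p : n.Partition} (π : Equiv.Perm (Fin n)) (t : Tableau p) :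
    π • t.tabloid = (π • t).tabloid := rfl

/-! ### Young permutation lattices, polytabloids, Specht lattices over the integers -/

/-- The Young permutation lattice over `ℤ`: the free `ℤ`-module on the set of tabloids, on which the
symmetric group acts by permuting this basis. -/
def youngRep {n : ℕ} (p : n.Partition) :
    Representation ℤ (Equiv.Perm (Fin n)) (Tabloid p →₀ ℤ) where
  toFun π := Finsupp.lmapDomain ℤ ℤ (π • ·)
  map_one' := by ext; simp
  map_mul' a b := by ext; simp [mul_smul]

theorem youngRep_single {n : ℕ} {p : n.Partition} (π : Equiv.Perm (Fin n)) (x : Tabloid p)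
    (a : ℤ) : youngRep p π (Finsupp.single x a) = Finsupp.single (π • x) a := by
  simp [youngRep]

/-- The polytabloid `e_t = ∑_{σ ∈ C_t} sgn(σ) {σ t}`. -/
def polytabloid {n : ℕ} {p : n.Partition} (t : Tableau p) : Tabloid p →₀ ℤ :=
  ∑ σ : t.colStabilizer,
    (Equiv.Perm.sign (σ : Equiv.Perm (Fin n)) : ℤ) •
      Finsupp.single (((σ : Equiv.Perm (Fin n)) • t).tabloid) (1 : ℤ)

theorem youngRep_polytabloid {n : ℕ} {p : n.Partition} (π : Equiv.Perm (Fin n)) (t : Tableau p) :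
    youngRep p π (polytabloid t) = polytabloid (π • t) := by
  unfold polytabloid
  rw [map_sum]
  let f : t.colStabilizer ≃ (π • t).colStabilizer :=
    { toFun := fun σ => ⟨π * σ.1 * π⁻¹, by
        rw [Tableau.mem_colStabilizer_smul]; simp [mul_assoc]⟩
      invFun := fun σ => ⟨π⁻¹ * σ.1 * π, Tableau.mem_colStabilizer_smul.1 σ.2⟩
      left_inv := fun σ => Subtype.ext (by simp [mul_assoc])
      right_inv := fun σ => Subtype.ext (by simp [mul_assoc]) }
  refine Fintype.sum_equiv f _ _ fun σ => ?_
  rw [map_zsmul, youngRep_single, smul_tabloid]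
  simp [f, mul_smul, mul_right_comm]

/-- The Specht lattice over `ℤ`, as a subrepresentation of the Young permutation lattice: the
`ℤ`-span of all polytabloids. By `spechtSub_eq_span_orbit` it is the cyclic sublattice generated by
any single polytabloid. -/
def spechtSub {n : ℕ} (p : n.Partition) : Subrepresentation (youngRep p) where
  toSubmodule := Submodule.span ℤ (Set.range polytabloid)
  apply_mem_toSubmodule π v hv := by
    have h : Submodule.span ℤ (Set.range polytabloid) ≤
        (Submodule.span ℤ (Set.range polytabloid)).comap (youngRep p π) := by
      rw [Submodule.span_le]
      rintro _ ⟨t, rfl⟩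
      exact Submodule.subset_span ⟨π • t, (youngRep_polytabloid π t).symm⟩
    exact h hv

theorem spechtSub_eq_span_orbit {n : ℕ} {p : n.Partition} (t : Tableau p) :
    (spechtSub p).toSubmodule =
      Submodule.span ℤ (Set.range fun π => youngRep p π (polytabloid t)) := by
  refine congrArg (Submodule.span ℤ) (Set.ext fun x => ⟨?_, ?_⟩)
  · rintro ⟨s, rfl⟩
    obtain ⟨π, rfl⟩ := Tableau.exists_smul_eq t s
    exact ⟨π, youngRep_polytabloid π t⟩
  · rintro ⟨π, rfl⟩
    exact ⟨π • t, (youngRep_polytabloid π t).symm⟩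

/-! ### Specht lattices over an arbitrary coefficient ring, and the sign lattice -/

/-- The underlying `R`-module `R ⊗_ℤ S^p_ℤ` of the Specht lattice over `R`. -/
abbrev SpechtModule (R : Type*) [CommRing R] {n : ℕ} (p : n.Partition) : Type _ :=
  R ⊗[ℤ] (spechtSub p).toSubmodule

/-- The Specht lattice `S^p_R = R ⊗_ℤ S^p_ℤ`, with the symmetric group acting on the right-hand
tensor factor. -/
def spechtRep (R : Type*) [CommRing R] {n : ℕ} (p : n.Partition) :
    Representation R (Equiv.Perm (Fin n)) (SpechtModule R p) where
  toFun π := ((spechtSub p).toRepresentation π).baseChange R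
  map_one' := by rw [map_one, Module.End.one_eq_id, LinearMap.baseChange_id]; rfl
  map_mul' a b := by rw [map_mul, Module.End.mul_eq_comp, LinearMap.baseChange_comp]; rfl

/-- The sign lattice `sgn_R`: rank one, with `σ` acting by multiplication with `sgn(σ)`. -/
def signRep (R : Type*) [CommRing R] (n : ℕ) : Representation R (Equiv.Perm (Fin n)) R where
  toFun π := ((Equiv.Perm.sign π : ℤ) : R) • LinearMap.id
  map_one' := by ext; simp
  map_mul' a b := by ext; simp [mul_comm]

/-- A representation is a lattice if its underlying `R`-module is finitely generated and free. -/
def IsLattice {R G V : Type*} [CommRing R] [Group G] [AddCommGroup V] [Module R V]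
    (_ρ : Representation R G V) : Prop :=
  Module.Finite R V ∧ Module.Free R V

end Specht

end

noncomputable section

namespace Specht

namespace Tableau

variable {n : ℕ} {p : n.Partition}

/-! Over ℤ, pair S^{λ'} with S^λ by ⟨x, e_t⟩ = sgn(t) · (coefficient of x at {t'}), where t' is the
transposed tableau and sgn(t) is taken relative to a fixed tableau. This respects the linear
relations among the e_t by the symmetry `sign_mul_polytabloid_apply`: for x = e_{s'} the value is
sgn(s) times the coefficient of e_t at {s}, which is linear in e_t. The factor sgn(t) produces the
sign twist in the equivariance.

An x pairing to zero with every e_t has no nonzero coefficient, so the map to the dual is injective.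
Surjectivity rests on standard tableaux. A functional is determined by its values on standard
polytabloids (`functional_eq_zero_of_standard`, from the Garnir relations), and the coefficients of
e_t at {s}, for s and t standard, form a unitriangular matrix (`polytabloid_apply_self`,
`polytabloid_apply_eq_zero`), so all such values are attained over ℤ. Straightening functionals
instead of vectors allows a positive integer factor to be cancelled, so Garnir sums may run over a
full symmetric group instead of coset representatives.

Finally S^λ is finite free over ℤ, so forming the dual commutes with extension of scalars to R. -/

theorem cell_mem (t : Tableau p) (i : Fin n) : (t.rowOf i, t.colOf i) ∈ p.diagram :=
  (Equiv.symm t i).2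

theorem exists_entry (t : Tableau p) {r c : ℕ} (h : (r, c) ∈ p.diagram) :
    ∃ i, t.rowOf i = r ∧ t.colOf i = c :=
  ⟨Equiv.toFun t ⟨(r, c), h⟩, by
    have := Equiv.symm_apply_apply t ⟨(r, c), h⟩
    exact ⟨congrArg (fun x => x.1.1) this, congrArg (fun x => x.1.2) this⟩⟩

theorem eq_of_rowOf_eq_of_colOf_eq (t : Tableau p) {i j : Fin n} (hr : t.rowOf i = t.rowOf j)
    (hc : t.colOf i = t.colOf j) : i = j :=
  (Equiv.symm t).injective (Subtype.ext (Prod.ext hr hc))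

theorem ext_of_rowOf_of_colOf {t s : Tableau p} (hr : t.rowOf = s.rowOf)
    (hc : t.colOf = s.colOf) : t = s := by
  have h : Equiv.symm t = Equiv.symm s :=
    Equiv.ext fun i => Subtype.ext (Prod.ext (congrFun hr i) (congrFun hc i))
  exact Equiv.symm_bijective.1 h

instance : Finite (Tableau p) :=
  inferInstanceAs (Finite ({c : ℕ × ℕ // c ∈ p.diagram.cells} ≃ Fin n))

theorem smul_eq_self_iff {t : Tableau p} {σ : Equiv.Perm (Fin n)} : σ • t = t ↔ σ = 1 := by
  refine ⟨fun h => ?_, fun h => by rw [h, one_smul]⟩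
  have h' : Equiv.trans t σ = t := h
  ext i
  have h1 : Equiv.toFun t (Equiv.symm t i) = i := Equiv.apply_symm_apply t i
  have h2 : σ (Equiv.toFun t (Equiv.symm t i)) = Equiv.toFun t (Equiv.symm t i) :=
    congrArg (fun e : Tableau p => Equiv.toFun e (Equiv.symm t i)) h'
  rw [h1] at h2
  exact congrArg Fin.val h2

theorem rowOf_smul_eq_iff {t : Tableau p} {σ : Equiv.Perm (Fin n)} :
    (σ • t).rowOf = t.rowOf ↔ σ ∈ t.rowStabilizer := by
  rw [← inv_mem_iff, mem_rowStabilizer, funext_iff]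
  rfl

theorem colOf_smul_eq_iff {t : Tableau p} {σ : Equiv.Perm (Fin n)} :
    (σ • t).colOf = t.colOf ↔ σ ∈ t.colStabilizer := by
  rw [← inv_mem_iff, mem_colStabilizer, funext_iff]
  rfl

theorem tabloid_eq_iff {t s : Tableau p} : t.tabloid = s.tabloid ↔ t.rowOf = s.rowOf := by
  refine Quotient.eq.trans ⟨?_, fun h => ?_⟩
  · rintro ⟨σ, hσ, rfl⟩
    exact (rowOf_smul_eq_iff.2 hσ).symm
  · obtain ⟨σ, rfl⟩ := exists_smul_eq t s
    exact ⟨σ, rowOf_smul_eq_iff.1 h.symm, rfl⟩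

theorem exists_tabloid_eq (x : Tabloid p) : ∃ t : Tableau p, t.tabloid = x :=
  Quotient.exists_rep x

/-! ### Transposition of tableaux -/

theorem swap_mem_diagram_conjugate {c : ℕ × ℕ} :
    c ∈ p.diagram.cells ↔ Equiv.prodComm ℕ ℕ c ∈ p.conjugate.diagram.cells := by
  rw [p.diagram_conjugate, YoungDiagram.mem_cells, YoungDiagram.mem_cells,
    YoungDiagram.mem_transpose]
  rfl

/-- The transposed tableau, as a bijection from tableaux of a shape to tableaux of the conjugate
shape. -/
def transpose : Tableau p ≃ Tableau p.conjugate :=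
  Equiv.equivCongr ((Equiv.prodComm ℕ ℕ).subtypeEquiv fun _ => swap_mem_diagram_conjugate)
    (Equiv.refl _)

theorem rowOf_transpose (t : Tableau p) : (transpose t).rowOf = t.colOf := rfl

theorem transpose_smul (σ : Equiv.Perm (Fin n)) (t : Tableau p) :
    transpose (σ • t) = σ • transpose t := rfl

theorem mem_colStabilizer_transpose {t : Tableau p} {σ : Equiv.Perm (Fin n)} :
    σ ∈ (transpose t).colStabilizer ↔ σ ∈ t.rowStabilizer := Iff.rfl

/-! ### Standard tableaux -/

/-- The entries increase down every column. -/
def ColStandard (t : Tableau p) : Prop :=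
  ∀ i j, t.colOf i = t.colOf j → t.rowOf i < t.rowOf j → i < j

/-- The entries increase along every row and down every column. -/
def Standard (t : Tableau p) : Prop :=
  t.ColStandard ∧ (transpose t).ColStandard

/-- In an increasing column the row index of an entry counts the smaller entries of that column, so
the columns alone determine a column-standard tableau. -/
theorem ColStandard.rowOf_eq_card {t : Tableau p} (ht : t.ColStandard) (i : Fin n) :
    t.rowOf i = (Finset.univ.filter fun k => t.colOf k = t.colOf i ∧ k < i).card := by
  have himg : (Finset.univ.filter fun k => t.colOf k = t.colOf i ∧ k < i).image t.rowOf =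
      Finset.range (t.rowOf i) := by
    ext r
    simp only [Finset.mem_image, Finset.mem_filter, Finset.mem_univ, true_and, Finset.mem_range]
    constructor
    · rintro ⟨k, ⟨hc, hk⟩, rfl⟩
      by_contra hr
      rcases (not_lt.1 hr).lt_or_eq with h | h
      · exact (ht i k hc.symm h).not_gt hk
      · exact hk.ne (t.eq_of_rowOf_eq_of_colOf_eq h.symm hc)
    · intro hr
      obtain ⟨k, hk, hkc⟩ := t.exists_entry
        (p.diagram.up_left_mem hr.le le_rfl (t.cell_mem i))
      exact ⟨k, ⟨hkc, ht k i hkc (hk ▸ hr)⟩, hk⟩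
  rw [← Finset.card_range (t.rowOf i), ← himg, Finset.card_image_of_injOn]
  intro a ha b hb hab
  simp only [Finset.coe_filter, Finset.mem_univ, true_and, Set.mem_ofPred_eq] at ha hb
  exact t.eq_of_rowOf_eq_of_colOf_eq hab (ha.1.trans hb.1.symm)

theorem ColStandard.eq_of_colOf_eq {t s : Tableau p} (ht : t.ColStandard) (hs : s.ColStandard)
    (h : t.colOf = s.colOf) : t = s :=
  ext_of_rowOf_of_colOf (funext fun i => by rw [ht.rowOf_eq_card, hs.rowOf_eq_card, h]) h

theorem Standard.eq_of_tabloid_eq {t s : Tableau p} (ht : t.Standard) (hs : s.Standard)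
    (h : t.tabloid = s.tabloid) : t = s :=
  transpose.injective (ht.2.eq_of_colOf_eq hs.2 (tabloid_eq_iff.1 h))

/-! ### Weights, and their behaviour under column rearrangements -/

/-- The sum of the entries, weighted by their row indices. -/
def rowWeight (t : Tableau p) : ℕ := ∑ i, t.rowOf i * i

/-- The sum of the entries, weighted by their column indices. -/
def colWeight (t : Tableau p) : ℕ := ∑ i, t.colOf i * i

theorem rowWeight_smul (t : Tableau p) (σ : Equiv.Perm (Fin n)) :
    (σ • t).rowWeight = ∑ i, t.rowOf i * σ i := by
  refine Fintype.sum_equiv σ⁻¹ _ _ fun i => ?_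
  simp [rowOf_smul]

theorem colWeight_smul (t : Tableau p) (σ : Equiv.Perm (Fin n)) :
    (σ • t).colWeight = ∑ i, t.colOf i * σ i := by
  refine Fintype.sum_equiv σ⁻¹ _ _ fun i => ?_
  simp [colOf_smul]

/-- Exchanging an inverted pair within a column moves the larger entry to the row of larger index.
-/
theorem rowWeight_lt_of_not_colStandard {t : Tableau p} (ht : ¬ t.ColStandard) :
    ∃ σ ∈ t.colStabilizer, t.rowWeight < (σ • t).rowWeight := by
  simp only [ColStandard, not_forall, not_lt] at ht
  obtain ⟨i, j, hc, hr, hij⟩ := ht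
  have hne : j ≠ i := by rintro rfl; exact hr.ne rfl
  have hlt : j < i := lt_of_le_of_ne hij hne
  refine ⟨Equiv.swap i j, fun k => ?_, ?_⟩
  · rcases eq_or_ne k i with rfl | hki
    · rw [Equiv.swap_apply_left, hc]
    rcases eq_or_ne k j with rfl | hkj
    · rw [Equiv.swap_apply_right, hc]
    · rw [Equiv.swap_apply_of_ne_of_ne hki hkj]
  · have hsplit : ∀ f : Fin n → ℕ, ∑ k, f k = (f i + f j) +
        ∑ k ∈ (Finset.univ.erase i).erase j, f k := fun f => by
      rw [add_assoc, Finset.add_sum_erase _ f (by simp [hne]), Finset.add_sum_erase _ f (by simp)]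
    rw [rowWeight_smul, rowWeight, hsplit, hsplit fun k => t.rowOf k * _]
    refine add_lt_add_of_lt_of_le ?_ (Finset.sum_le_sum fun k hk => ?_)
    · rw [Equiv.swap_apply_left, Equiv.swap_apply_right]
      have h : (j : ℕ) < i := hlt
      nlinarith
    · simp only [Finset.mem_erase, Finset.mem_univ, and_true] at hk
      rw [Equiv.swap_apply_of_ne_of_ne hk.2 hk.1]

theorem colStabilizer_smul {t : Tableau p} {σ : Equiv.Perm (Fin n)} (hσ : σ ∈ t.colStabilizer) :
    (σ • t).colStabilizer = t.colStabilizer := by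
  ext τ
  rw [mem_colStabilizer, mem_colStabilizer, colOf_smul_eq_iff.2 hσ]

theorem colStandard_of_forall_rowWeight_le {t : Tableau p} {σ : Equiv.Perm (Fin n)}
    (hσ : σ ∈ t.colStabilizer)
    (h : ∀ τ ∈ t.colStabilizer, (τ • t).rowWeight ≤ (σ • t).rowWeight) :
    (σ • t).ColStandard := by
  by_contra hn
  obtain ⟨τ, hτ, hlt⟩ := rowWeight_lt_of_not_colStandard hn
  rw [colStabilizer_smul hσ] at hτ
  rw [← mul_smul] at hlt
  exact (h _ (mul_mem hτ hσ)).not_gt hlt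

theorem exists_maximal_rowWeight (t : Tableau p) : ∃ σ ∈ t.colStabilizer,
    ∀ τ ∈ t.colStabilizer, (τ • t).rowWeight ≤ (σ • t).rowWeight := by
  obtain ⟨σ, hσ⟩ := Finite.exists_max fun σ : t.colStabilizer => (σ.1 • t).rowWeight
  exact ⟨σ, σ.2, fun τ hτ => hσ ⟨τ, hτ⟩⟩

theorem exists_smul_colStandard (t : Tableau p) :
    ∃ σ ∈ t.colStabilizer, (σ • t).ColStandard :=
  let ⟨σ, hσ, h⟩ := t.exists_maximal_rowWeight
  ⟨σ, hσ, colStandard_of_forall_rowWeight_le hσ h⟩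

/-- Maximizers of the row weight among column rearrangements are column standard, and there is only
one column-standard rearrangement. -/
theorem ColStandard.rowWeight_smul_lt {t : Tableau p} (ht : t.ColStandard)
    {σ : Equiv.Perm (Fin n)} (hσ : σ ∈ t.colStabilizer) (h1 : σ ≠ 1) :
    (σ • t).rowWeight < t.rowWeight := by
  have huniq : ∀ τ ∈ t.colStabilizer, (τ • t).ColStandard → τ = 1 := fun τ hτ h =>
    smul_eq_self_iff.1 (h.eq_of_colOf_eq ht (colOf_smul_eq_iff.2 hτ))
  obtain ⟨τ, hτ, hmax⟩ := t.exists_maximal_rowWeight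
  obtain rfl := huniq τ hτ (colStandard_of_forall_rowWeight_le hτ hmax)
  rw [one_smul] at hmax
  refine (hmax σ hσ).lt_of_ne fun heq => h1 (huniq σ hσ ?_)
  exact colStandard_of_forall_rowWeight_le hσ fun τ hτ => heq ▸ hmax τ hτ

end Tableau

variable {n : ℕ} {p : n.Partition}

/-! ### Signs and Garnir relations -/

/-- Summing over the whole group lets later reindexings multiply by a permutation without
transporting the index subtype. -/
theorem polytabloid_eq_sum_ite (t : Tableau p) :
    polytabloid t = ∑ σ : Equiv.Perm (Fin n), if σ ∈ t.colStabilizer then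
      (Equiv.Perm.sign σ : ℤ) • Finsupp.single ((σ • t).tabloid) (1 : ℤ) else 0 := by
  rw [polytabloid, ← Finset.sum_filter]
  exact (Finset.sum_subtype _ (by simp) fun σ : Equiv.Perm (Fin n) =>
    (Equiv.Perm.sign σ : ℤ) • Finsupp.single ((σ • t).tabloid) (1 : ℤ)).symm

theorem polytabloid_smul {t : Tableau p} {π : Equiv.Perm (Fin n)} (hπ : π ∈ t.colStabilizer) :
    polytabloid (π • t) = (Equiv.Perm.sign π : ℤ) • polytabloid t := by
  rw [polytabloid_eq_sum_ite, polytabloid_eq_sum_ite, Finset.smul_sum]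
  refine Fintype.sum_equiv (Equiv.mulRight π) _ _ fun σ => ?_
  have hst := Tableau.colStabilizer_smul hπ
  rw [Equiv.coe_mulRight, mul_smul]
  by_cases hσ : σ ∈ t.colStabilizer
  · rw [if_pos (hst ▸ hσ), if_pos (mul_mem hσ hπ), map_mul]
    rcases Int.units_eq_one_or (Equiv.Perm.sign π) with h | h <;> simp [h]
  · rw [if_neg (hst ▸ hσ), if_neg fun h => hσ ((Subgroup.mul_mem_cancel_right _ hπ).1 h), smul_zero]

/-- The permutations that move only elements of a given finite set. -/
def permsOn (X : Finset (Fin n)) : Finset (Equiv.Perm (Fin n)) :=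
  Finset.univ.filter fun π => ∀ i, i ∉ X → π i = i

theorem mem_permsOn {X : Finset (Fin n)} {π : Equiv.Perm (Fin n)} :
    π ∈ permsOn X ↔ ∀ i, i ∉ X → π i = i := by
  simp [permsOn]

theorem apply_mem_of_mem_permsOn {X : Finset (Fin n)} {π : Equiv.Perm (Fin n)}
    (hπ : π ∈ permsOn X) {i : Fin n} (hi : i ∈ X) : π i ∈ X := by
  by_contra h
  exact h (by rwa [π.injective (mem_permsOn.1 hπ _ h)])

theorem mul_swap_mem_permsOn {X : Finset (Fin n)} {x y : Fin n} (hx : x ∈ X) (hy : y ∈ X)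
    {π : Equiv.Perm (Fin n)} : π * Equiv.swap x y ∈ permsOn X ↔ π ∈ permsOn X := by
  have key : ∀ ρ : Equiv.Perm (Fin n), ρ ∈ permsOn X → ρ * Equiv.swap x y ∈ permsOn X := by
    intro ρ hρ
    rw [mem_permsOn] at hρ ⊢
    intro i hi
    rw [Equiv.Perm.mul_apply, Equiv.swap_apply_of_ne_of_ne, hρ i hi]
    · rintro rfl; exact hi hx
    · rintro rfl; exact hi hy
  refine ⟨fun h => ?_, key π⟩
  simpa [mul_assoc] using key _ h

/-- Right multiplication by the transposition of x and y keeps each tabloid and flips its sign, so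
the sum equals its own negative. -/
theorem sum_permsOn_single_eq_zero {X : Finset (Fin n)} {t : Tableau p} {x y : Fin n}
    (hx : x ∈ X) (hy : y ∈ X) (hxy : x ≠ y) (hrow : t.rowOf x = t.rowOf y) :
    ∑ π ∈ permsOn X, (Equiv.Perm.sign π : ℤ) •
      Finsupp.single ((π • t).tabloid) (1 : ℤ) = 0 := by
  have hmem : Equiv.swap x y ∈ t.rowStabilizer := fun k => by
    rcases eq_or_ne k x with rfl | hkx
    · rw [Equiv.swap_apply_left, hrow]
    rcases eq_or_ne k y with rfl | hky
    · rw [Equiv.swap_apply_right, hrow]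
    · rw [Equiv.swap_apply_of_ne_of_ne hkx hky]
  have htab : ∀ π : Equiv.Perm (Fin n), ((π * Equiv.swap x y) • t).tabloid = (π • t).tabloid :=
    fun π => by
      rw [mul_smul, ← smul_tabloid, ← smul_tabloid π t,
        Tableau.tabloid_eq_iff.2 (Tableau.rowOf_smul_eq_iff.2 hmem)]
  refine self_eq_neg.1 ?_
  rw [← Finset.sum_neg_distrib]
  refine Finset.sum_equiv (Equiv.mulRight (Equiv.swap x y))
    (fun π => (mul_swap_mem_permsOn hx hy).symm) fun π _ => ?_
  rw [Equiv.coe_mulRight, htab, map_mul, Equiv.Perm.sign_swap hxy]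
  simp

/-- Garnir relation: antisymmetrizing a polytabloid over a set of entries annihilates it as soon as
every column rearrangement puts two of these entries into the same row. -/
theorem sum_permsOn_polytabloid_eq_zero {X : Finset (Fin n)} {t : Tableau p}
    (h : ∀ σ ∈ t.colStabilizer, ∃ x ∈ X, ∃ y ∈ X, x ≠ y ∧
      (σ • t).rowOf x = (σ • t).rowOf y) :
    ∑ π ∈ permsOn X, (Equiv.Perm.sign π : ℤ) • polytabloid (π • t) = 0 := by
  have h1 : ∀ π : Equiv.Perm (Fin n), (Equiv.Perm.sign π : ℤ) • polytabloid (π • t) =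
      ∑ σ : t.colStabilizer, (Equiv.Perm.sign (σ : Equiv.Perm (Fin n)) : ℤ) •
        ((Equiv.Perm.sign π : ℤ) •
          Finsupp.single ((π • (σ : Equiv.Perm (Fin n)) • t).tabloid) (1 : ℤ)) := fun π => by
    rw [← youngRep_polytabloid, polytabloid, map_sum, Finset.smul_sum]
    refine Finset.sum_congr rfl fun σ _ => ?_
    rw [map_zsmul, youngRep_single, smul_tabloid, smul_comm]
  -- For fixed σ, the inner sum antisymmetrizes the tabloid of `σ • t`, in which two entries of `X`
  -- share a row.
  rw [Finset.sum_congr rfl fun π _ => h1 π, Finset.sum_comm]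
  refine Finset.sum_eq_zero fun σ _ => ?_
  obtain ⟨x, hx, y, hy, hxy, hrow⟩ := h σ σ.2
  rw [← Finset.smul_sum, sum_permsOn_single_eq_zero hx hy hxy hrow, smul_zero]

namespace Tableau

/-! ### Row descents and Garnir sets -/

/-- If horizontally adjacent entries were always in order, induction on the column distance would
make every row increase. -/
theorem exists_adjacent_descent {t : Tableau p} (h : ¬ (transpose t).ColStandard) :
    ∃ i j, t.rowOf i = t.rowOf j ∧ t.colOf j = t.colOf i + 1 ∧ j < i := by
  by_contra hn
  push Not at hn
  refine h fun i j hr hc => ?_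
  change t.rowOf i = t.rowOf j at hr
  change t.colOf i < t.colOf j at hc
  obtain ⟨d, hd⟩ := Nat.exists_eq_add_of_lt hc
  induction d generalizing j with
  | zero =>
    refine (hn i j hr hd).lt_of_ne ?_
    rintro rfl
    exact hc.ne rfl
  | succ d ih =>
    obtain ⟨k, hkr, hkc⟩ := t.exists_entry (p.diagram.up_left_mem le_rfl
      (show t.colOf i + d + 1 ≤ t.colOf j by omega) (t.cell_mem j))
    have h1 : i < k := ih k (hr.trans hkr.symm) (by omega) hkc
    exact h1.trans_le (hn k j hkr (by omega))

/-- The entries of column `c` in row `r` or below, and of column `c + 1` in row `r` or above. -/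
def garnirSet (t : Tableau p) (r c : ℕ) : Finset (Fin n) :=
  Finset.univ.filter fun x => (t.colOf x = c ∧ r ≤ t.rowOf x) ∨ (t.colOf x = c + 1 ∧ t.rowOf x ≤ r)

theorem mem_garnirSet {t : Tableau p} {r c : ℕ} {x : Fin n} : x ∈ t.garnirSet r c ↔
    (t.colOf x = c ∧ r ≤ t.rowOf x) ∨ (t.colOf x = c + 1 ∧ t.rowOf x ≤ r) := by
  simp [garnirSet]

/-- Column c contributes at least colLen c − r entries and column c + 1 at least r + 1. -/
theorem colLen_lt_card_garnirSet (t : Tableau p) {r c : ℕ} (h : (r, c + 1) ∈ p.diagram) :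
    p.diagram.colLen c < (t.garnirSet r c).card := by
  have hr : r < p.diagram.colLen c :=
    YoungDiagram.mem_iff_lt_colLen.1 (p.diagram.up_left_mem le_rfl (Nat.le_succ c) h)
  let A := Finset.univ.filter fun x => t.colOf x = c ∧ r ≤ t.rowOf x
  let B := Finset.univ.filter fun x => t.colOf x = c + 1 ∧ t.rowOf x ≤ r
  have hX : t.garnirSet r c = A ∪ B := by
    ext x
    simp [mem_garnirSet, A, B]
  have hdisj : Disjoint A B := by
    rw [Finset.disjoint_left]
    intro x hA hB
    simp only [A, B, Finset.mem_filter, Finset.mem_univ, true_and] at hA hB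
    omega
  have hA : p.diagram.colLen c - r ≤ A.card := by
    rw [← Nat.card_Ico]
    refine (Finset.card_le_card fun k hk => ?_).trans (Finset.card_image_le (f := t.rowOf))
    rw [Finset.mem_Ico] at hk
    obtain ⟨x, hx, hxc⟩ := t.exists_entry (YoungDiagram.mem_iff_lt_colLen.2 hk.2)
    exact Finset.mem_image.2 ⟨x, by simp [A, hx, hxc, hk.1], hx⟩
  have hB : r + 1 ≤ B.card := by
    rw [← Finset.card_range (r + 1)]
    refine (Finset.card_le_card fun k hk => ?_).trans (Finset.card_image_le (f := t.rowOf))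
    rw [Finset.mem_range, Nat.lt_succ_iff] at hk
    obtain ⟨x, hx, hxc⟩ := t.exists_entry (p.diagram.up_left_mem hk le_rfl h)
    exact Finset.mem_image.2 ⟨x, by simp [B, hx, hxc, hk], hx⟩
  rw [hX, Finset.card_union_of_disjoint hdisj]
  omega

/-- Pigeonhole: after a column rearrangement the set still lies in columns c and c + 1, which meet
only the first colLen c rows. -/
theorem exists_rowOf_eq_of_mem_garnirSet (t : Tableau p) {r c : ℕ} (h : (r, c + 1) ∈ p.diagram)
    {σ : Equiv.Perm (Fin n)} (hσ : σ ∈ t.colStabilizer) :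
    ∃ x ∈ t.garnirSet r c, ∃ y ∈ t.garnirSet r c, x ≠ y ∧
      (σ • t).rowOf x = (σ • t).rowOf y := by
  refine Finset.exists_ne_map_eq_of_card_lt_of_maps_to
    (t := Finset.range (p.diagram.colLen c)) ?_ fun x hx => ?_
  · rw [Finset.card_range]
    exact t.colLen_lt_card_garnirSet h
  · have hc : c ≤ t.colOf x ∧ t.colOf x = (σ • t).colOf x := by
      rw [colOf_smul_eq_iff.2 hσ]
      rcases mem_garnirSet.1 hx with h | h <;> omega
    rw [Finset.coe_range, Set.mem_Iio, ← YoungDiagram.mem_iff_lt_colLen]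
    exact p.diagram.up_left_mem le_rfl (hc.1.trans_eq hc.2) ((σ • t).cell_mem x)

/-- Column standardness puts every left-column entry of the Garnir set above every right-column one,
so columns and entries are oppositely ordered there. The rearrangement inequality then makes the
column weight minimal, and equality forces π to preserve columns. -/
theorem ColStandard.colWeight_lt {t : Tableau p} (ht : t.ColStandard) {i j : Fin n}
    (hr : t.rowOf i = t.rowOf j) (hc : t.colOf j = t.colOf i + 1) (hij : j < i)
    {π : Equiv.Perm (Fin n)} (hπ : π ∈ permsOn (t.garnirSet (t.rowOf i) (t.colOf i)))
    (hπc : π ∉ t.colStabilizer) : t.colWeight < (π • t).colWeight := by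
  set X := t.garnirSet (t.rowOf i) (t.colOf i) with hX
  have hfix := mem_permsOn.1 hπ
  have hcol : ∀ x ∈ X, t.colOf x = t.colOf i ∨ t.colOf x = t.colOf j := fun x hx => by
    rcases mem_garnirSet.1 hx with h | h <;> omega
  have hlt : ∀ x ∈ X, ∀ y ∈ X, t.colOf x = t.colOf i → t.colOf y = t.colOf j → y < x := by
    intro x hx y hy hxc hyc
    have hx' : t.rowOf i ≤ t.rowOf x := by rcases mem_garnirSet.1 hx with h | h <;> omega
    have hy' : t.rowOf y ≤ t.rowOf j := by rcases mem_garnirSet.1 hy with h | h <;> omega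
    have h1 : i ≤ x := by
      rcases hx'.lt_or_eq with h | h
      · exact (ht i x hxc.symm h).le
      · exact (t.eq_of_rowOf_eq_of_colOf_eq h hxc.symm).le
    have h2 : y ≤ j := by
      rcases hy'.lt_or_eq with h | h
      · exact (ht y j hyc h).le
      · exact (t.eq_of_rowOf_eq_of_colOf_eq h hyc).le
    exact h2.trans_lt (hij.trans_le h1)
  have hanti : AntivaryOn t.colOf (fun x : Fin n => (x : ℕ)) (X : Set (Fin n)) := by
    intro x hx y hy hxy
    by_contra hn
    have hx2 := hcol x hx
    have hy2 := hcol y hy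
    exact (hlt x hx y hy (by omega) (by omega)).not_gt hxy
  have hout : ∑ x ∈ Xᶜ, t.colOf x * (π x : ℕ) = ∑ x ∈ Xᶜ, t.colOf x * (x : ℕ) :=
    Finset.sum_congr rfl fun x hx => by rw [hfix x (Finset.mem_compl.1 hx)]
  have hsupp : {x | π x ≠ x} ⊆ (X : Set (Fin n)) := fun x hx => by
    by_contra h
    exact hx (hfix x h)
  rw [colWeight_smul, colWeight, ← Finset.sum_add_sum_compl X,
    ← Finset.sum_add_sum_compl X (fun x => t.colOf x * (π x : ℕ)), hout, add_lt_add_iff_right,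
    hanti.sum_mul_lt_sum_mul_comp_perm_iff hsupp]
  intro hanti'
  -- An injection of a finite set into itself is onto: if π keeps the entries of column d in place,
  -- nothing else enters that column.
  have hpre : ∀ d, (∀ x ∈ X, t.colOf x = d → t.colOf (π x) = d) →
      ∀ x ∈ X, t.colOf (π x) = d → t.colOf x = d := by
    intro d hd x hx hxd
    let S := X.filter fun x => t.colOf x = d
    have hmaps : Set.MapsTo π S S := fun y hy => by
      simp only [S, Finset.coe_filter, Set.mem_ofPred_eq] at hy ⊢
      exact ⟨apply_mem_of_mem_permsOn hπ hy.1, hd y hy.1 hy.2⟩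
    have hsurj := Finset.surjOn_of_injOn_of_card_le π hmaps π.injective.injOn le_rfl
    obtain ⟨y, hy, hyx⟩ := hsurj (show π x ∈ (S : Set (Fin n)) by
      simp only [S, Finset.coe_filter, Set.mem_ofPred_eq]
      exact ⟨apply_mem_of_mem_permsOn hπ hx, hxd⟩)
    rw [π.injective hyx] at hy
    simp only [S, Finset.coe_filter, Set.mem_ofPred_eq] at hy
    exact hy.2
  -- If a and b trade columns, then π a < π b although a lies in the smaller column, against
  -- `hanti'`.
  have hcross : ∀ a ∈ X, ∀ b ∈ X, t.colOf a = t.colOf i → t.colOf b = t.colOf j →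
      t.colOf (π a) = t.colOf j → t.colOf (π b) = t.colOf i → False := by
    intro a ha b hb hac hbc ha' hb'
    have h1 := hlt _ (apply_mem_of_mem_permsOn hπ hb) _ (apply_mem_of_mem_permsOn hπ ha) hb' ha'
    have h2 := hanti' ha hb h1
    omega
  have hcol' : ∀ x ∈ X, t.colOf (π x) = t.colOf i ∨ t.colOf (π x) = t.colOf j :=
    fun x hx => hcol _ (apply_mem_of_mem_permsOn hπ hx)
  have hi : ∀ x ∈ X, t.colOf x = t.colOf i → t.colOf (π x) = t.colOf i := by
    intro a ha hac
    by_contra hne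
    have ha' := (hcol' a ha).resolve_left hne
    have hj : ∀ b ∈ X, t.colOf b = t.colOf j → t.colOf (π b) = t.colOf j := fun b hb hbc =>
      (hcol' b hb).resolve_left fun hb' => hcross a ha b hb hac hbc ha' hb'
    have := hpre _ hj a ha ha'
    omega
  refine hπc fun x => ?_
  by_cases hx : x ∈ X
  · rcases hcol x hx with h | h
    · rw [hi x hx h, h]
    · rcases hcol' x hx with h' | h'
      · rw [h', hpre _ hi x hx h']
      · rw [h', h]
  · rw [hfix x hx]

end Tableau

/-! ### Straightening of functionals on the Specht lattice -/

/-- The polytabloid as an element of the Specht lattice. -/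
def spechtPolytabloid (t : Tableau p) : (spechtSub p).toSubmodule :=
  ⟨polytabloid t, Submodule.subset_span ⟨t, rfl⟩⟩

theorem span_spechtPolytabloid :
    Submodule.span ℤ (Set.range (spechtPolytabloid (p := p))) = ⊤ := by
  refine Submodule.map_injective_of_injective (spechtSub p).toSubmodule.injective_subtype ?_
  rw [Submodule.map_span, Submodule.map_top, Submodule.range_subtype, ← Set.range_comp]
  rfl

theorem linearMap_ext_polytabloid {M : Type*} [AddCommGroup M]
    {f g : (spechtSub p).toSubmodule →ₗ[ℤ] M}
    (h : ∀ t, f (spechtPolytabloid t) = g (spechtPolytabloid t)) : f = g :=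
  LinearMap.ext_on_range span_spechtPolytabloid h

theorem spechtPolytabloid_smul {t : Tableau p} {π : Equiv.Perm (Fin n)}
    (hπ : π ∈ t.colStabilizer) :
    spechtPolytabloid (π • t) = (Equiv.Perm.sign π : ℤ) • spechtPolytabloid t :=
  Subtype.ext (polytabloid_smul hπ)

theorem toRepresentation_spechtPolytabloid (π : Equiv.Perm (Fin n)) (t : Tableau p) :
    (spechtSub p).toRepresentation π (spechtPolytabloid t) = spechtPolytabloid (π • t) :=
  Subtype.ext (youngRep_polytabloid π t)

theorem garnir_relation (t : Tableau p) {r c : ℕ} (h : (r, c + 1) ∈ p.diagram) :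
    ∑ π ∈ permsOn (t.garnirSet r c),
      (Equiv.Perm.sign π : ℤ) • spechtPolytabloid (π • t) = 0 := by
  refine Subtype.ext ?_
  have := sum_permsOn_polytabloid_eq_zero fun σ hσ => t.exists_rowOf_eq_of_mem_garnirSet h hσ
  rw [AddSubmonoidClass.coe_finsetSum]
  exact this

/-- A functional on the Specht lattice that vanishes on the standard polytabloids is zero. -/
theorem functional_eq_zero_of_standard (f : (spechtSub p).toSubmodule →ₗ[ℤ] ℤ)
    (hf : ∀ t : Tableau p, t.Standard → f (spechtPolytabloid t) = 0) : f = 0 := by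
  refine linearMap_ext_polytabloid fun t => ?_
  -- Induction on the distance to the maximal column weight, which the Garnir relation decreases.
  obtain ⟨t₀, hmax⟩ := Finite.exists_max fun s : Tableau p => s.colWeight
  rw [LinearMap.zero_apply]
  induction hd : t₀.colWeight - t.colWeight using Nat.strong_induction_on generalizing t with
  | _ d ih =>
  obtain ⟨σ, hσ, hstd⟩ := t.exists_smul_colStandard
  have hweight : (σ • t).colWeight = t.colWeight := by
    simp only [Tableau.colWeight, Tableau.colOf_smul_eq_iff.2 hσ]
  suffices hs : f (spechtPolytabloid (σ • t)) = 0 by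
    rw [spechtPolytabloid_smul hσ, map_smul, smul_eq_zero] at hs
    exact hs.resolve_left (Units.ne_zero _)
  rw [← hweight] at hd
  generalize σ • t = s at hd hstd
  by_cases hrow : (Tableau.transpose s).ColStandard
  · exact hf s ⟨hstd, hrow⟩
  obtain ⟨i, j, hr, hc, hij⟩ := Tableau.exists_adjacent_descent hrow
  have hcell : (s.rowOf i, s.colOf i + 1) ∈ p.diagram := by
    rw [hr, ← hc]
    exact s.cell_mem j
  have hterm : ∀ π ∈ permsOn (s.garnirSet (s.rowOf i) (s.colOf i)),
      f ((Equiv.Perm.sign π : ℤ) • spechtPolytabloid (π • s)) =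
        if π ∈ s.colStabilizer then f (spechtPolytabloid s) else 0 := by
    intro π hπ
    split_ifs with hπc
    · rw [spechtPolytabloid_smul hπc, smul_smul, Int.units_coe_mul_self, one_smul]
    · have hlt := hstd.colWeight_lt hr hc hij hπ hπc
      rw [map_smul, ih _ (by have := hmax (π • s); omega) _ rfl, smul_zero]
  have hg := congrArg f (garnir_relation s hcell)
  -- What remains is a multiple of `f (spechtPolytabloid s)` by the number of column-preserving π.
  -- This number is nonzero because of the identity, and ℤ has no torsion.
  rw [map_sum, map_zero, Finset.sum_congr rfl hterm, ← Finset.sum_filter, Finset.sum_const,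
    smul_eq_zero, Finset.card_eq_zero] at hg
  refine hg.resolve_left (Finset.Nonempty.ne_empty ⟨1, ?_⟩)
  rw [Finset.mem_filter, mem_permsOn]
  exact ⟨fun _ _ => rfl, one_mem _⟩

end Specht

/-- A unitriangular linear system, with respect to a weight function, is solvable. -/
theorem Finset.exists_sum_mul_eq_of_unitriangular {ι R : Type*} [CommRing R] [DecidableEq ι]
    (S : Finset ι) (w : ι → ℕ) (g : ι → ι → R) (h1 : ∀ i ∈ S, g i i = 1)
    (h0 : ∀ i ∈ S, ∀ j ∈ S, i ≠ j → w j ≤ w i → g i j = 0) (h : ι → R) :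
    ∃ c : ι → R, ∀ j ∈ S, ∑ i ∈ S, c i * g i j = h j := by
  induction S using Finset.induction_on_max_value w with
  | empty => exact ⟨0, by simp⟩
  | insert a S ha hmax ih =>
    obtain ⟨c, hc⟩ := ih (fun i hi => h1 i (Finset.mem_insert_of_mem hi)) fun i hi j hj =>
      h0 i (Finset.mem_insert_of_mem hi) j (Finset.mem_insert_of_mem hj)
    have hsum : ∀ x j, ∑ i ∈ insert a S, Function.update c a x i * g i j =
        x * g a j + ∑ i ∈ S, c i * g i j := fun x j => by
      rw [Finset.sum_insert ha, Function.update_self]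
      refine congrArg _ (Finset.sum_congr rfl fun i hi => ?_)
      rw [Function.update_of_ne (by rintro rfl; exact ha hi)]
    -- As `a` has maximal weight, `g a j` vanishes for j in `S`: the old equations are undisturbed,
    -- and the one at `a` dictates the new coefficient.
    refine ⟨Function.update c a (h a - ∑ i ∈ S, c i * g i a), fun j hj => ?_⟩
    rw [hsum]
    rcases Finset.mem_insert.1 hj with rfl | hj'
    · rw [h1 j hj]
      ring
    · rw [h0 a (Finset.mem_insert_self a S) j hj (by rintro rfl; exact ha hj') (hmax j hj'),
        hc j hj', mul_zero, zero_add]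

namespace Specht

variable {n : ℕ} {p : n.Partition}

/-! ### Coefficients of polytabloids -/

theorem polytabloid_apply_tabloid (s t : Tableau p) :
    polytabloid s t.tabloid = ∑ σ : Equiv.Perm (Fin n),
      if σ ∈ s.colStabilizer ∧ (σ • s).rowOf = t.rowOf then (Equiv.Perm.sign σ : ℤ) else 0 := by
  rw [polytabloid_eq_sum_ite, Finsupp.finsetSum_apply]
  refine Finset.sum_congr rfl fun σ _ => ?_
  classical
  by_cases hσ : σ ∈ s.colStabilizer
  · rw [if_pos hσ, Finsupp.smul_apply, Finsupp.single_apply, Tableau.tabloid_eq_iff]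
    simp [hσ]
  · simp [hσ]

/-- Coefficients of polytabloids of conjugate shapes agree up to sign. -/
theorem polytabloid_apply_smul_tabloid (s : Tableau p) (π : Equiv.Perm (Fin n)) :
    polytabloid s (π • s).tabloid = (Equiv.Perm.sign π : ℤ) *
      polytabloid (Tableau.transpose (π • s)) (Tableau.transpose s).tabloid := by
  rw [polytabloid_apply_tabloid, polytabloid_apply_tabloid, Finset.mul_sum]
  -- The left sum runs over σ for which `σ • s` has the columns of `s` and the rows of `π • s`.
  -- Written as τ = σπ⁻¹ acting on `π • s`, the two conditions exchange roles under transposition.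
  refine Fintype.sum_equiv (Equiv.mulRight π⁻¹) _ _ fun σ => ?_
  have h1 : σ • s = (σ * π⁻¹) • π • s := by rw [← mul_smul, inv_mul_cancel_right]
  have hiff : (σ ∈ s.colStabilizer ∧ (σ • s).rowOf = (π • s).rowOf) ↔
      (σ * π⁻¹ ∈ (Tableau.transpose (π • s)).colStabilizer ∧
        ((σ * π⁻¹) • Tableau.transpose (π • s)).rowOf = (Tableau.transpose s).rowOf) := by
    rw [← Tableau.transpose_smul, ← h1, Tableau.rowOf_transpose, Tableau.rowOf_transpose,
      Tableau.colOf_smul_eq_iff, Tableau.mem_colStabilizer_transpose, h1,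
      Tableau.rowOf_smul_eq_iff, and_comm]
  rw [Equiv.coe_mulRight]
  by_cases h : σ ∈ s.colStabilizer ∧ (σ • s).rowOf = (π • s).rowOf
  · rw [if_pos h, if_pos (hiff.1 h), map_mul, Equiv.Perm.sign_inv, mul_comm (Equiv.Perm.sign σ),
      Units.val_mul, ← mul_assoc, Int.units_coe_mul_self, one_mul]
  · rw [if_neg h, if_neg (mt hiff.2 h), mul_zero]

/-- The sign of the permutation carrying a fixed reference tableau to the given one. -/
def Tableau.sign (t : Tableau p) : ℤˣ :=
  Equiv.Perm.sign (Equiv.trans (Equiv.symm (Classical.arbitrary (Tableau p))) t)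

theorem Tableau.sign_smul (π : Equiv.Perm (Fin n)) (t : Tableau p) :
    (π • t).sign = Equiv.Perm.sign π * t.sign :=
  map_mul Equiv.Perm.sign π (Equiv.trans (Equiv.symm (Classical.arbitrary (Tableau p))) t)

/-- Normalizing by tableau signs absorbs sgn(π) and makes the relation symmetric; this is what makes
the pairing well defined. -/
theorem sign_mul_polytabloid_apply (s t : Tableau p) :
    (t.sign : ℤ) * polytabloid s t.tabloid =
      s.sign * polytabloid (Tableau.transpose t) (Tableau.transpose s).tabloid := by
  obtain ⟨π, rfl⟩ := Tableau.exists_smul_eq s t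
  rw [polytabloid_apply_smul_tabloid, Tableau.sign_smul, Units.val_mul, ← mul_assoc,
    mul_right_comm (Equiv.Perm.sign π : ℤ), Int.units_coe_mul_self, one_mul]

theorem polytabloid_apply_self (t : Tableau p) : polytabloid t t.tabloid = 1 := by
  rw [polytabloid_apply_tabloid, Finset.sum_eq_single 1]
  · rw [if_pos ⟨one_mem _, by rw [one_smul]⟩, Equiv.Perm.sign_one, Units.val_one]
  · intro σ _ h1
    refine if_neg fun h => h1 (Tableau.smul_eq_self_iff (t := t).1 ?_)
    exact Tableau.ext_of_rowOf_of_colOf h.2 (Tableau.colOf_smul_eq_iff.2 h.1)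
  · simp

/-- The row weight depends only on the tabloid, and {t} has strictly the largest row weight among
the tabloids occurring in e_t. -/
theorem polytabloid_apply_eq_zero {s t : Tableau p} (hs : s.Standard) (ht : t.Standard)
    (hst : s ≠ t) (hw : t.rowWeight ≤ s.rowWeight) : polytabloid t s.tabloid = 0 := by
  rw [polytabloid_apply_tabloid]
  refine Finset.sum_eq_zero fun σ _ => if_neg fun ⟨hσ, hrow⟩ => ?_
  rcases eq_or_ne σ 1 with rfl | h1
  · rw [one_smul] at hrow
    exact hst (hs.eq_of_tabloid_eq ht (Tableau.tabloid_eq_iff.2 hrow.symm))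
  · have h2 := ht.1.rowWeight_smul_lt hσ h1
    have h3 : (σ • t).rowWeight = s.rowWeight := by simp only [Tableau.rowWeight, hrow]
    omega

/-! ### The pairing of Specht lattices of conjugate shapes -/

/-- Evaluation of functionals at all polytabloids. -/
def dualEval (p : n.Partition) :
    Module.Dual ℤ (spechtSub p).toSubmodule →ₗ[ℤ] (Tableau p → ℤ) where
  toFun f t := f (spechtPolytabloid t)
  map_add' _ _ := rfl
  map_smul' _ _ := rfl

theorem dualEval_injective : Function.Injective (dualEval p) := fun _ _ h =>
  linearMap_ext_polytabloid (congrFun h)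

/-- The signed coefficients at all transposed tabloids. -/
def signedCoeff (p : n.Partition) :
    (spechtSub p.conjugate).toSubmodule →ₗ[ℤ] (Tableau p → ℤ) where
  toFun x t := t.sign * x.1 (Tableau.transpose t).tabloid
  map_add' _ _ := funext fun _ => mul_add _ _ _
  map_smul' _ _ := funext fun _ => mul_left_comm _ _ _

theorem signedCoeff_spechtPolytabloid (s t : Tableau p) :
    signedCoeff p (spechtPolytabloid (Tableau.transpose s)) t =
      s.sign * polytabloid t s.tabloid :=
  (sign_mul_polytabloid_apply t s).symm

/-- The generator e_{s'} yields sgn(s) times the coefficient functional at {s}, so the prescribed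
values on polytabloids do come from a functional. -/
theorem range_signedCoeff_le :
    LinearMap.range (signedCoeff p) ≤ LinearMap.range (dualEval p) := by
  rw [LinearMap.range_eq_map, ← span_spechtPolytabloid, Submodule.map_span_le]
  rintro _ ⟨u, rfl⟩
  obtain ⟨s, rfl⟩ := Tableau.transpose.surjective u
  refine ⟨(s.sign : ℤ) • (Finsupp.lapply s.tabloid).comp (spechtSub p).toSubmodule.subtype, ?_⟩
  funext t
  exact (signedCoeff_spechtPolytabloid s t).symm

/-- The map from the Specht lattice of the conjugate shape to the dual Specht lattice. -/
def conjugateToDual (p : n.Partition) :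
    (spechtSub p.conjugate).toSubmodule →ₗ[ℤ] Module.Dual ℤ (spechtSub p).toSubmodule :=
  (LinearEquiv.ofInjective (dualEval p) dualEval_injective).symm.toLinearMap ∘ₗ
    (signedCoeff p).codRestrict _ fun x => range_signedCoeff_le ⟨x, rfl⟩

theorem conjugateToDual_apply (x : (spechtSub p.conjugate).toSubmodule) (t : Tableau p) :
    conjugateToDual p x (spechtPolytabloid t) =
      t.sign * x.1 (Tableau.transpose t).tabloid := by
  have h : LinearEquiv.ofInjective (dualEval p) dualEval_injective (conjugateToDual p x) =
      (signedCoeff p).codRestrict _ (fun x => range_signedCoeff_le ⟨x, rfl⟩) x :=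
    LinearEquiv.apply_symm_apply _ _
  exact congrFun (congrArg Subtype.val h) t

/-- Every tabloid of the conjugate shape is the tabloid of some transposed tableau, so all
coefficients of x are seen. -/
theorem conjugateToDual_injective : Function.Injective (conjugateToDual p) := by
  rw [injective_iff_map_eq_zero]
  intro x hx
  refine Subtype.ext (Finsupp.ext fun u => ?_)
  obtain ⟨v, rfl⟩ := Tableau.exists_tabloid_eq u
  obtain ⟨t, rfl⟩ := Tableau.transpose.surjective v
  have h := conjugateToDual_apply x t
  rw [hx, LinearMap.zero_apply, eq_comm, mul_eq_zero] at h
  exact h.resolve_left (Units.ne_zero _)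

theorem conjugateToDual_surjective : Function.Surjective (conjugateToDual p) := by
  classical
  intro f
  have := Fintype.ofFinite (Tableau p)
  let S : Finset (Tableau p) := Finset.univ.filter Tableau.Standard
  have hS : ∀ t, t ∈ S ↔ t.Standard := fun t => by simp [S]
  obtain ⟨c, hc⟩ := S.exists_sum_mul_eq_of_unitriangular Tableau.rowWeight
    (fun s t => polytabloid t s.tabloid) (fun t _ => polytabloid_apply_self t)
    (fun s hs t ht => polytabloid_apply_eq_zero ((hS s).1 hs) ((hS t).1 ht))
    fun t => f (spechtPolytabloid t)
  -- The factor `s.sign` cancels the one in `signedCoeff_spechtPolytabloid`.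
  refine ⟨∑ s ∈ S, c s • (s.sign : ℤ) • spechtPolytabloid (Tableau.transpose s), ?_⟩
  refine sub_eq_zero.1 (functional_eq_zero_of_standard _ fun t ht => ?_)
  rw [LinearMap.sub_apply, ← hc t ((hS t).2 ht), sub_eq_zero, map_sum, LinearMap.sum_apply]
  refine Finset.sum_congr rfl fun s _ => ?_
  rw [map_smul, map_smul, LinearMap.smul_apply, LinearMap.smul_apply, conjugateToDual_apply]
  change c s * (s.sign * signedCoeff p (spechtPolytabloid (Tableau.transpose s)) t) = _
  rw [signedCoeff_spechtPolytabloid, ← mul_assoc (s.sign : ℤ), Int.units_coe_mul_self, one_mul]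

/-- The Specht lattice of the conjugate shape is dual to the Specht lattice. -/
def conjugateEquivDual (p : n.Partition) :
    (spechtSub p.conjugate).toSubmodule ≃ₗ[ℤ] Module.Dual ℤ (spechtSub p).toSubmodule :=
  LinearEquiv.ofBijective (conjugateToDual p) ⟨conjugateToDual_injective,
    conjugateToDual_surjective⟩

theorem youngRep_apply (π : Equiv.Perm (Fin n)) (x : Tabloid p →₀ ℤ) (u : Tabloid p) :
    youngRep p π x u = x (π⁻¹ • u) := by
  have h := Finsupp.mapDomain_apply (MulAction.injective π) x (π⁻¹ • u)
  rw [smul_inv_smul] at h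
  exact h

/-- The coefficient of πx at {t'} is that of x at {π⁻¹t'}, and replacing t by π⁻¹t changes its sign
by sgn(π). -/
theorem conjugateEquivDual_toRepresentation (π : Equiv.Perm (Fin n))
    (x : (spechtSub p.conjugate).toSubmodule) (y : (spechtSub p).toSubmodule) :
    conjugateEquivDual p ((spechtSub p.conjugate).toRepresentation π x) y =
      (Equiv.Perm.sign π : ℤ) *
        conjugateEquivDual p x ((spechtSub p).toRepresentation π⁻¹ y) := by
  suffices h : conjugateToDual p ((spechtSub p.conjugate).toRepresentation π x) =
      (Equiv.Perm.sign π : ℤ) •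
        (conjugateToDual p x).comp ((spechtSub p).toRepresentation π⁻¹) from
    LinearMap.congr_fun h y
  refine linearMap_ext_polytabloid fun t => ?_
  rw [conjugateToDual_apply, LinearMap.smul_apply, LinearMap.comp_apply,
    toRepresentation_spechtPolytabloid, conjugateToDual_apply, Tableau.sign_smul]
  change _ * youngRep p.conjugate π x.1 _ = _
  rw [youngRep_apply, smul_tabloid, Tableau.transpose_smul, smul_eq_mul, Units.val_mul,
    Equiv.Perm.sign_inv, ← mul_assoc, ← mul_assoc, Int.units_coe_mul_self, one_mul]

/-! ### Extension of scalars -/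

instance : Finite (Tabloid p) := Quotient.finite _

instance : Module.Finite ℤ (spechtSub p).toSubmodule :=
  Module.Finite.of_fg (IsNoetherian.noetherian _)

variable (R : Type*) [CommRing R]

/-- The Specht lattice of the conjugate shape, tensored with the sign lattice, is dual to the Specht
lattice, over any commutative ring. -/
def conjugateTensorSignEquivDual (p : n.Partition) :
    SpechtModule R p.conjugate ⊗[R] R ≃ₗ[R] Module.Dual R (SpechtModule R p) :=
  (TensorProduct.rid R _).trans <| ((conjugateEquivDual p).baseChange ℤ R _ _).trans
    (TensorProduct.isBaseChange ℤ (spechtSub p).toSubmodule R).toDualBaseChange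

theorem conjugateTensorSignEquivDual_tmul (a b c : R) (x : (spechtSub p.conjugate).toSubmodule)
    (y : (spechtSub p).toSubmodule) :
    conjugateTensorSignEquivDual R p ((a ⊗ₜ x) ⊗ₜ b) (c ⊗ₜ y) =
      c * (b * a * (conjugateEquivDual p x y : ℤ)) := by
  have h1 : (c ⊗ₜ[ℤ] y : SpechtModule R p) = c • (1 ⊗ₜ y) := by
    rw [TensorProduct.smul_tmul', smul_eq_mul, mul_one]
  rw [h1, map_smul, smul_eq_mul]
  refine congrArg (c * ·) ?_
  simp only [conjugateTensorSignEquivDual, LinearEquiv.trans_apply, TensorProduct.rid_tmul,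
    TensorProduct.smul_tmul', smul_eq_mul]
  exact (TensorProduct.isBaseChange ℤ (spechtSub p).toSubmodule R).toDualBaseChange_tmul _ _ _

theorem conjugateTensorSignEquivDual_comp (π : Equiv.Perm (Fin n)) :
    (conjugateTensorSignEquivDual R p).toLinearMap ∘ₗ
        ((spechtRep R p.conjugate).tprod (signRep R n)) π =
      (spechtRep R p).dual π ∘ₗ (conjugateTensorSignEquivDual R p).toLinearMap := by
  refine TensorProduct.ext' fun w b => ?_
  refine LinearMap.ext fun z => ?_
  induction w using TensorProduct.induction_on with
  | zero => simp
  | add w₁ w₂ h₁ h₂ =>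
    simp only [TensorProduct.add_tmul, map_add, LinearMap.add_apply, h₁, h₂]
  | tmul a x =>
  induction z using TensorProduct.induction_on with
  | zero => simp
  | add z₁ z₂ h₁ h₂ => simp only [map_add, h₁, h₂]
  | tmul c y =>
    change conjugateTensorSignEquivDual R p ((a ⊗ₜ (spechtSub p.conjugate).toRepresentation π x) ⊗ₜ
        (((Equiv.Perm.sign π : ℤ) : R) * b)) (c ⊗ₜ y) =
      conjugateTensorSignEquivDual R p ((a ⊗ₜ x) ⊗ₜ b) (c ⊗ₜ (spechtSub p).toRepresentation π⁻¹ y)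
    rw [conjugateTensorSignEquivDual_tmul, conjugateTensorSignEquivDual_tmul,
      conjugateEquivDual_toRepresentation, Int.cast_mul]
    -- One sign comes from the sign lattice and one from the integral duality; they cancel.
    have hs : ((Equiv.Perm.sign π : ℤ) : R) * ((Equiv.Perm.sign π : ℤ) : R) = 1 := by
      rw [← Int.cast_mul, Int.units_coe_mul_self, Int.cast_one]
    linear_combination (c * b * a *
      (conjugateEquivDual p x ((spechtSub p).toRepresentation π⁻¹ y) : ℤ)) * hs

end Specht

end

theorem propositionA9 (R : Type*) [CommRing R] [IsDomain R] [IsPrincipalIdealRing R]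
    (n : ℕ) (p : n.Partition) :
    Specht.IsLattice ((Specht.spechtRep R p.conjugate).tprod (Specht.signRep R n)) ∧
    Specht.IsLattice (Specht.spechtRep R p).dual ∧
    Nonempty (Representation.Equiv
      ((Specht.spechtRep R p.conjugate).tprod (Specht.signRep R n))
      (Specht.spechtRep R p).dual) :=
  ⟨⟨inferInstance, inferInstance⟩, ⟨inferInstance, inferInstance⟩,
    ⟨.mk (Specht.conjugateTensorSignEquivDual R p)
      (Specht.conjugateTensorSignEquivDual_comp R)⟩⟩
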